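/- Let $|\psi\rangle=(|00\rangle+|11\rangle)/\sqrt2$ and, for $1/3\le F\le 1$, consider the two-qubit state $$\rho(F)=F\,|\psi\rangle\langle\psi|+(1-F)\,|01\rangle\langle 01| .$$ For a two-qubit state $\rho$ let $F(\rho)=\max_{\phi}\langle\phi|\rho|\phi\rangle$, the maximum being over all maximally entangled pure two-qubit states $\phi$ (its fidelity, or maximal singlet fraction), and let $F^*(\rho)$ be the supremum of $F(\Lambda(\rho))$ over all trace-preserving LOCC operations $\Lambda$ from two qubits to two qubits (finitely many rounds of local measurements with arbitrary finite-dimensional ancillas, and two-way classical communication). A filter is a complex $2\times2$ matrix $A$ with $A^\dagger A\le I$. For filters $A,B$ put $p_{AB}=\mathrm{tr}\big((A\otimes B)\rho(A\otimes B)^\dagger\big)$, $\rho_f=(A\otimes B)\rho(A\otimes B)^\dagger/p_{AB}$, and $K_{AB}(\rho)=p_{AB}F(\rho_f)+(1-p_{AB})/2$ (with $K_{AB}(\rho)=1/2$ if $p_{AB}=0$). Call a filter $A$ optimal for $\rho$ if * $K_{A'B'}(\rho)\le K_{AI}(\rho)$ for all filters $A',B'$; and * the following is an LOCC protocol that maps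 $\rho$ to a state of fidelity $F^*(\rho)$: Alice applies the filter $A$; on success nothing more is done; on failure the parties prepare a pure product state $|\chi\rangle$. Here $|\chi\rangle$ is any pure product state with $|\langle\chi|\phi\rangle|^2=1/2$ for some maximally entangled $\phi$ with $\langle\phi|\rho_f|\phi\rangle=F(\rho_f)$, where $\rho_f$ is taken with $B=I$; such $|\chi\rangle$ exist. Then $F(\rho(F))=F$, the supremum $F^*(\rho(F))$ is attained, and: 1. If $1/3\le F\le 2/3$, then $A=\mathrm{diag}\left[\frac{F}{2(1-F)},\,1\right]$ is an optimal filter for $\rho(F)$, and $$F^*(\rho(F))=\frac12\left(1+\frac{F^2}{4(1-F)}\right).$$ 2. If $2/3\le F\le 1$, then the identity $A=I$ is an optimal filter for $\rho(F)$, and $F^*(\rho(F))=F$; hence $F(\Lambda(\rho(F)))\le F(\rho(F))$ for every trace-preserving LOCC operation $\Lambda$, so no LOCC protocol increases the fidelity. -/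

import Mathlib

open scoped Matrix Kronecker ComplexOrder

noncomputable section

/-- Operators on the bipartite space `ℂ^m ⊗ ℂ^n`; the pair `(i, j)` labels `|i⟩_A ⊗ |j⟩_B`. -/
abbrev BiOp (m n : ℕ) : Type := Matrix (Fin m × Fin n) (Fin m × Fin n) ℂ

/-- Vectors of the two-qubit space `ℂ² ⊗ ℂ²`. -/
abbrev TwoQubitVec : Type := Fin 2 × Fin 2 → ℂ

/-- `|φ⟩⟨φ|`. -/
def ketbra {ι : Type*} (φ : ι → ℂ) : Matrix ι ι ℂ := Matrix.vecMulVec φ (star φ)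

/-- `⟨φ|ρ|φ⟩` (a real number for Hermitian `ρ`). -/
def expectation {ι : Type*} [Fintype ι] (φ : ι → ℂ) (ρ : Matrix ι ι ℂ) : ℝ :=
  (star φ ⬝ᵥ (ρ *ᵥ φ)).re

/-- The product vector `α ⊗ β`. -/
def productVec (α β : Fin 2 → ℂ) : TwoQubitVec := fun p => α p.1 * β p.2

/-- A unit vector of `ℂ^ι` with the Euclidean norm. -/
def IsUnitVec {ι : Type*} [Fintype ι] (φ : ι → ℂ) : Prop := star φ ⬝ᵥ φ = 1

/-- A two-qubit pure state is maximally entangled when its reduced state on either qubit is the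
maximally mixed state `I/2`. -/
def IsMaximallyEntangled (φ : TwoQubitVec) : Prop :=
  (∀ i j, ∑ k, φ (i, k) * star (φ (j, k)) = if i = j then 1 / 2 else 0) ∧
  (∀ i j, ∑ k, φ (k, i) * star (φ (k, j)) = if i = j then 1 / 2 else 0)

/-- The fidelity (maximal singlet fraction): the maximum of `⟨φ|ρ|φ⟩` over all maximally
entangled `φ`. The set is compact and nonempty, so the supremum is a maximum. -/
def fidelity (ρ : BiOp 2 2) : ℝ :=
  sSup {x | ∃ φ, IsMaximallyEntangled φ ∧ x = expectation φ ρ}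

/-- The completely positive map `σ ↦ K σ Kᴴ`. -/
def sandwich {ι κ : Type*} [Fintype ι] [Fintype κ] (K : Matrix κ ι ℂ) :
    Matrix ι ι ℂ →ₗ[ℂ] Matrix κ κ ℂ where
  toFun σ := K * σ * Kᴴ
  map_add' σ τ := by rw [Matrix.mul_add, Matrix.add_mul]
  map_smul' c σ := by simp

/-- `IsLOCC Λ`: the map `Λ`, from operators on `ℂ^m ⊗ ℂ^n` to operators on `ℂ^a ⊗ ℂ^b`, is realized
by a protocol of local operations and (two-way) classical communication with finitely many rounds.
In each round one party performs a complete local measurement with Kraus operators `K i`,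
`∑ i, (K i)ᴴ * K i = 1`, whose outcome spaces may have any finite dimensions `d i`, and announces the
outcome `i`; the rest of the protocol may depend on `i`. Ancillas, discarded subsystems,
unannounced outcomes and shared randomness are special cases. Since every measurement is complete,
these maps are trace preserving. -/
inductive IsLOCC {a b : ℕ} : {m n : ℕ} → (BiOp m n →ₗ[ℂ] BiOp a b) → Prop
  | stop_here : IsLOCC (LinearMap.id : BiOp a b →ₗ[ℂ] BiOp a b)
  | alice {m n k : ℕ} (d : Fin k → ℕ) (K : ∀ i, Matrix (Fin (d i)) (Fin m) ℂ)
      (complete : ∑ i, (K i)ᴴ * K i = 1)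
      (Λ : ∀ i, BiOp (d i) n →ₗ[ℂ] BiOp a b) (rest : ∀ i, IsLOCC (Λ i)) :
      IsLOCC (∑ i, Λ i ∘ₗ sandwich (K i ⊗ₖ (1 : Matrix (Fin n) (Fin n) ℂ)))
  | bob {m n k : ℕ} (d : Fin k → ℕ) (K : ∀ i, Matrix (Fin (d i)) (Fin n) ℂ)
      (complete : ∑ i, (K i)ᴴ * K i = 1)
      (Λ : ∀ i, BiOp m (d i) →ₗ[ℂ] BiOp a b) (rest : ∀ i, IsLOCC (Λ i)) :
      IsLOCC (∑ i, Λ i ∘ₗ sandwich ((1 : Matrix (Fin m) (Fin m) ℂ) ⊗ₖ K i))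

/-- The fidelities reachable from the two-qubit state `ρ` by trace-preserving LOCC. -/
def loccFidelities (ρ : BiOp 2 2) : Set ℝ :=
  {x | ∃ Λ : BiOp 2 2 →ₗ[ℂ] BiOp 2 2, IsLOCC Λ ∧ x = fidelity (Λ ρ)}

/-- `F*(ρ)`, the maximal fidelity reachable from `ρ` by trace-preserving LOCC. -/
def Fstar (ρ : BiOp 2 2) : ℝ := sSup (loccFidelities ρ)

/-- A local filter: a complex `2 × 2` matrix with `Aᴴ A ≤ I`. -/
def IsFilter (A : Matrix (Fin 2) (Fin 2) ℂ) : Prop := (1 - Aᴴ * A).PosSemidef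

/-- The probability `p = tr((A ⊗ B) ρ (A ⊗ B)ᴴ)` that `ρ` passes the filters `A` and `B`. -/
def successProb (A B : Matrix (Fin 2) (Fin 2) ℂ) (ρ : BiOp 2 2) : ℝ :=
  (sandwich (A ⊗ₖ B) ρ).trace.re

/-- The normalized state `ρ_f` after `ρ` has passed the filters `A` and `B`. -/
def filteredState (A B : Matrix (Fin 2) (Fin 2) ℂ) (ρ : BiOp 2 2) : BiOp 2 2 :=
  (successProb A B ρ)⁻¹ • sandwich (A ⊗ₖ B) ρ

/-- The cost function `K_{AB} = p F(ρ_f) + (1 - p)/2`. -/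
def filterValue (A B : Matrix (Fin 2) (Fin 2) ℂ) (ρ : BiOp 2 2) : ℝ :=
  successProb A B ρ * fidelity (filteredState A B ρ) + (1 - successProb A B ρ) / 2

/-- The deterministic protocol built on the filter `A`: Alice applies the filter; on success nothing
more is done, on failure the two parties prepare the pure product state `α ⊗ β`. -/
def filterProtocol (A : Matrix (Fin 2) (Fin 2) ℂ) (α β : Fin 2 → ℂ) :
    BiOp 2 2 →ₗ[ℂ] BiOp 2 2 :=
  sandwich (A ⊗ₖ (1 : Matrix (Fin 2) (Fin 2) ℂ)) +
    (Matrix.traceLinearMap (Fin 2 × Fin 2) ℂ ℂ -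
      Matrix.traceLinearMap (Fin 2 × Fin 2) ℂ ℂ ∘ₗ
        sandwich (A ⊗ₖ (1 : Matrix (Fin 2) (Fin 2) ℂ))).smulRight (ketbra (productVec α β))

/-- `α ⊗ β` is a suitable state to prepare on failure: a pure product state `χ` such that
`|⟨χ|φ⟩|² = 1/2` for a maximally entangled `φ` that realizes the fidelity of `ρ_f`. -/
def IsFailureState (A : Matrix (Fin 2) (Fin 2) ℂ) (ρ : BiOp 2 2) (α β : Fin 2 → ℂ) : Prop :=
  IsUnitVec α ∧ IsUnitVec β ∧ ∃ φ, IsMaximallyEntangled φ ∧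
    expectation φ (filteredState A 1 ρ) = fidelity (filteredState A 1 ρ) ∧
    ‖star (productVec α β) ⬝ᵥ φ‖ ^ 2 = 1 / 2

/-- `A`, used by Alice alone, is an optimal filter for `ρ`: it maximizes the cost function over all
pairs of local filters, and its protocol is an LOCC protocol that reaches `F*(ρ)`. -/
def IsOptimalFilter (ρ : BiOp 2 2) (A : Matrix (Fin 2) (Fin 2) ℂ) : Prop :=
  IsFilter A ∧
  (∀ A' B', IsFilter A' → IsFilter B' → filterValue A' B' ρ ≤ filterValue A 1 ρ) ∧
  (∃ α β, IsFailureState A ρ α β) ∧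
  ∀ α β, IsFailureState A ρ α β →
    IsLOCC (filterProtocol A α β) ∧ fidelity (filterProtocol A α β ρ) = Fstar ρ

/-- `|ψ⟩ = (|00⟩ + |11⟩)/√2`. -/
def psiVec : TwoQubitVec := fun p => if p.1 = p.2 then ((1 / √2 : ℝ) : ℂ) else 0

/-- `|01⟩`. -/
def ket01 : TwoQubitVec := Pi.single (0, 1) 1

/-- `ρ(F) = F |ψ⟩⟨ψ| + (1 - F) |01⟩⟨01|`. -/
def rhoF (F : ℝ) : BiOp 2 2 := F • ketbra psiVec + (1 - F) • ketbra ket01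

end

/-! The upper bound relaxes LOCC to the constraints of the partial transpose `Γ`. Conjugating a
local operation by `Γ` gives again a local operation, so `Γ ∘ Λ ∘ Γ` is positive and trace
preserving for every LOCC map `Λ`; and for maximally entangled `φ`, `|φ⟩⟨φ|^Γ` has eigenvalues
`±1/2`. Hence `f σ = ⟨φ|Λ σ|φ⟩` is nonnegative on positive `σ` and satisfies `|f (Q^Γ)| ≤ tr Q / 2`
for positive `Q`. This is `IsPPTForm`; the value of a filter pair tested on `φ` obeys it too, so one
bound serves both optimality claims.

If `ρ = Q^Γ - R^Γ - N` with `Q, R, N` positive, every such form has `f ρ ≤ (tr Q + tr R) / 2`.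
Explicit decompositions of `ρ(F)`, the first with `R = 0`, give the two claimed values.

For attainment, the filter `diag(a, 1)` tested on `ψ` has value `1/2 + F a / 2 - (1 - F) a² / 2`.
Its maximum over `0 ≤ a ≤ 1` is at `a = F / (2 (1 - F))` if `F ≤ 2/3` and at `a = 1` otherwise, and
equals the bound. `IsFilter.isOptimalFilter_of_forall_le` turns this coincidence into optimality of
the filter and of its protocol. -/

/-! ### Partial transposition and local operations -/

/-- The partial transpose on the second tensor factor. -/
def partialTranspose {m n : ℕ} : BiOp m n →ₗ[ℂ] BiOp m n where
  toFun σ := Matrix.of fun p q => σ (p.1, q.2) (q.1, p.2)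
  map_add' _ _ := rfl
  map_smul' _ _ := rfl

lemma partialTranspose_apply {m n : ℕ} (σ : BiOp m n) (p q : Fin m × Fin n) :
    partialTranspose σ p q = σ (p.1, q.2) (q.1, p.2) := rfl

lemma partialTranspose_partialTranspose {m n : ℕ} (σ : BiOp m n) :
    partialTranspose (partialTranspose σ) = σ := rfl

lemma trace_partialTranspose {m n : ℕ} (σ : BiOp m n) :
    (partialTranspose σ).trace = σ.trace := rfl

lemma trace_partialTranspose_mul {m n : ℕ} (σ τ : BiOp m n) :
    (partialTranspose σ * τ).trace = (σ * partialTranspose τ).trace := by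
  simp only [Matrix.trace, Matrix.diag, Matrix.mul_apply, partialTranspose_apply,
    Fintype.sum_prod_type]
  refine Finset.sum_congr rfl fun i _ => ?_
  rw [Finset.sum_comm]
  conv_rhs => rw [Finset.sum_comm]
  refine Finset.sum_congr rfl fun j _ => ?_
  rw [Finset.sum_comm]

lemma sandwich_apply {ι κ : Type*} [Fintype ι] [Fintype κ] (K : Matrix κ ι ℂ) (σ : Matrix ι ι ℂ) :
    sandwich K σ = K * σ * Kᴴ := rfl

lemma sandwich_kronecker_apply {m n m' n' : ℕ} (A : Matrix (Fin m') (Fin m) ℂ)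
    (B : Matrix (Fin n') (Fin n) ℂ) (σ : BiOp m n) (p q : Fin m' × Fin n') :
    sandwich (A ⊗ₖ B) σ p q = ∑ i, ∑ j, ∑ k, ∑ l,
      A p.1 i * B p.2 j * σ (i, j) (k, l) * (star (A q.1 k) * star (B q.2 l)) := by
  simp only [sandwich_apply, Matrix.mul_apply, Fintype.sum_prod_type, Matrix.kroneckerMap_apply,
    Matrix.conjTranspose_apply, Finset.sum_mul, star_mul']
  rw [Finset.sum_comm' (t' := Finset.univ) (s' := fun _ => Finset.univ) (by simp)]
  have h : ∀ f : Fin m → Fin n → Fin m → Fin n → ℂ,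
      ∑ k, ∑ l, ∑ i, ∑ j, f i j k l = ∑ i, ∑ j, ∑ k, ∑ l, f i j k l := by
    intro f
    have := Finset.sum_comm (s := (Finset.univ : Finset (Fin m × Fin n)))
      (t := (Finset.univ : Finset (Fin m × Fin n))) (f := fun a b => f b.1 b.2 a.1 a.2)
    simpa only [Fintype.sum_prod_type] using this
  rw [← h]
  rw [Finset.sum_comm' (t' := Finset.univ) (s' := fun _ => Finset.univ) (by simp)]

/-- Transposing Bob's factor replaces his operator by its complex conjugate, so the result still has
Kraus form. This is why local operations preserve positivity of the partial transpose. -/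
lemma partialTranspose_sandwich {m n m' n' : ℕ} (A : Matrix (Fin m') (Fin m) ℂ)
    (B : Matrix (Fin n') (Fin n) ℂ) (σ : BiOp m n) :
    partialTranspose (sandwich (A ⊗ₖ B) σ) =
      sandwich (A ⊗ₖ B.map star) (partialTranspose σ) := by
  ext p q
  simp only [partialTranspose_apply, sandwich_kronecker_apply, Matrix.map_apply, star_star]
  refine Finset.sum_congr rfl fun i _ => ?_
  rw [Finset.sum_comm]
  conv_rhs => rw [Finset.sum_comm]
  refine Finset.sum_congr rfl fun k _ => ?_
  rw [Finset.sum_comm]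
  refine Finset.sum_congr rfl fun j _ => Finset.sum_congr rfl fun l _ => ?_
  ring

lemma posSemidef_sandwich {ι κ : Type*} [Fintype ι] [Fintype κ] (K : Matrix κ ι ℂ)
    {σ : Matrix ι ι ℂ} (h : σ.PosSemidef) : (sandwich K σ).PosSemidef :=
  h.mul_mul_conjTranspose_same K

lemma trace_sandwich {ι κ : Type*} [Fintype ι] [Fintype κ] (K : Matrix κ ι ℂ) (σ : Matrix ι ι ℂ) :
    (sandwich K σ).trace = (Kᴴ * K * σ).trace := by
  rw [sandwich_apply, Matrix.trace_mul_comm, Matrix.mul_assoc]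

lemma posSemidef_sum {ι κ : Type*} (s : Finset κ) (f : κ → Matrix ι ι ℂ)
    (h : ∀ i ∈ s, (f i).PosSemidef) : (∑ i ∈ s, f i).PosSemidef :=
  Finset.sum_induction f Matrix.PosSemidef (fun _ _ => Matrix.PosSemidef.add) .zero h

/-- LOCC maps preserve positivity, positivity of the partial transpose, and the trace. -/
lemma IsLOCC.preserves {a b m n : ℕ} {Λ : BiOp m n →ₗ[ℂ] BiOp a b} (h : IsLOCC Λ) :
    (∀ σ, σ.PosSemidef → (Λ σ).PosSemidef) ∧
    (∀ σ, (partialTranspose σ).PosSemidef → (partialTranspose (Λ σ)).PosSemidef) ∧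
    ∀ σ, (Λ σ).trace = σ.trace := by
  induction h with
  | stop_here => exact ⟨fun _ h => h, fun _ h => h, fun _ => rfl⟩
  | @alice m n k d K complete Λ rest ih =>
    simp only [LinearMap.sum_apply, LinearMap.comp_apply, map_sum, Matrix.trace_sum]
    refine ⟨fun σ hσ => posSemidef_sum _ _ fun i _ => (ih i).1 _ (posSemidef_sandwich _ hσ),
      fun σ hσ => posSemidef_sum _ _ fun i _ => (ih i).2.1 _ ?_, fun σ => ?_⟩
    · rw [partialTranspose_sandwich]
      exact posSemidef_sandwich _ hσ
    · simp only [(ih _).2.2, trace_sandwich, Matrix.conjTranspose_kronecker,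
        ← Matrix.mul_kronecker_mul, ← Matrix.trace_sum, ← Finset.sum_mul]
      have : ∑ i, ((K i)ᴴ * K i) ⊗ₖ ((1 : Matrix (Fin n) (Fin n) ℂ)ᴴ * 1) = 1 := by
        rw [← Matrix.one_kronecker_one, ← complete]
        ext p q
        simp [Matrix.sum_apply, Finset.sum_mul]
      rw [this, Matrix.one_mul]
  | @bob m n k d K complete Λ rest ih =>
    simp only [LinearMap.sum_apply, LinearMap.comp_apply, map_sum, Matrix.trace_sum]
    refine ⟨fun σ hσ => posSemidef_sum _ _ fun i _ => (ih i).1 _ (posSemidef_sandwich _ hσ),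
      fun σ hσ => posSemidef_sum _ _ fun i _ => (ih i).2.1 _ ?_, fun σ => ?_⟩
    · rw [partialTranspose_sandwich]
      exact posSemidef_sandwich _ hσ
    · simp only [(ih _).2.2, trace_sandwich, Matrix.conjTranspose_kronecker,
        ← Matrix.mul_kronecker_mul, ← Matrix.trace_sum, ← Finset.sum_mul]
      have : ∑ i, ((1 : Matrix (Fin m) (Fin m) ℂ)ᴴ * 1) ⊗ₖ ((K i)ᴴ * K i) = 1 := by
        rw [← Matrix.one_kronecker_one, ← complete]
        ext p q
        simp [Matrix.sum_apply, Finset.mul_sum]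
      rw [this, Matrix.one_mul]

/-! ### Expectations and the partial transpose of maximally entangled projectors -/

lemma expectation_eq_trace {ι : Type*} [Fintype ι] (φ : ι → ℂ) (ρ : Matrix ι ι ℂ) :
    expectation φ ρ = (ketbra φ * ρ).trace.re := by
  rw [expectation, ketbra, Matrix.vecMulVec_mul, Matrix.trace_vecMulVec, Matrix.dotProduct_mulVec,
    dotProduct_comm]

/-- The real trace as a real linear form. -/
noncomputable def reTrace (m n : ℕ) : BiOp m n →ₗ[ℝ] ℝ :=
  Complex.reLm ∘ₗ (Matrix.traceLinearMap (Fin m × Fin n) ℂ ℂ).restrictScalars ℝ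

/-- `ρ ↦ ⟨φ|ρ|φ⟩` as a real linear form. -/
noncomputable def expectationForm (φ : TwoQubitVec) : BiOp 2 2 →ₗ[ℝ] ℝ where
  toFun := expectation φ
  map_add' σ τ := by simp [expectation_eq_trace, Matrix.mul_add]
  map_smul' c σ := by simp [expectation_eq_trace]

lemma expectationForm_apply (φ : TwoQubitVec) (σ : BiOp 2 2) :
    expectationForm φ σ = expectation φ σ := rfl

lemma posSemidef_ketbra {ι : Type*} [Fintype ι] (φ : ι → ℂ) : (ketbra φ).PosSemidef :=
  Matrix.posSemidef_vecMulVec_self_star φ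

lemma expectation_nonneg {ι : Type*} [Fintype ι] (φ : ι → ℂ) {ρ : Matrix ι ι ℂ}
    (h : ρ.PosSemidef) : 0 ≤ expectation φ ρ :=
  (Complex.le_def.1 (h.dotProduct_mulVec_nonneg φ)).1

lemma trace_re_nonneg {ι : Type*} [Fintype ι] {ρ : Matrix ι ι ℂ}
    (h : ρ.PosSemidef) : 0 ≤ ρ.trace.re :=
  (Complex.le_def.1 h.trace_nonneg).1

/-- The partial transpose of a maximally entangled projector squares to `1/4`. -/
lemma IsMaximallyEntangled.partialTranspose_sq {φ : TwoQubitVec} (h : IsMaximallyEntangled φ) :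
    partialTranspose (ketbra φ) * partialTranspose (ketbra φ) = (1 / 4 : ℂ) • (1 : BiOp 2 2) := by
  ext ⟨i, j⟩ ⟨k, l⟩
  -- The square is `ρ_A ⊗ ρ_Bᵀ` for the two reduced states of `φ`, each equal to `1/2`.
  have e : (partialTranspose (ketbra φ) * partialTranspose (ketbra φ)) (i, j) (k, l) =
      (∑ b, φ (i, b) * star (φ (k, b))) * (∑ a, φ (a, l) * star (φ (a, j))) := by
    simp only [Matrix.mul_apply, partialTranspose_apply, ketbra, Matrix.vecMulVec_apply,
      Pi.star_apply, Fintype.sum_prod_type, Fin.sum_univ_two]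
    ring
  rw [e, h.1, h.2, Matrix.smul_apply, Matrix.one_apply]
  by_cases h1 : i = k <;> by_cases h2 : j = l <;> (simp [h1, h2, eq_comm]; try norm_num)

lemma partialTranspose_isHermitian {m n : ℕ} {σ : BiOp m n} (h : σ.IsHermitian) :
    (partialTranspose σ).IsHermitian := by
  ext p q
  simp only [Matrix.conjTranspose_apply, partialTranspose_apply]
  exact h.apply _ _

/-- A Hermitian `H` with `H² = 1/4` has spectrum in `{±1/2}`. -/
lemma abs_trace_mul_le_of_sq {ι : Type*} [Fintype ι] [DecidableEq ι] {H Q : Matrix ι ι ℂ}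
    (hH : H.IsHermitian) (hsq : H * H = (1 / 4 : ℂ) • (1 : Matrix ι ι ℂ)) (hQ : Q.PosSemidef) :
    |(H * Q).trace.re| ≤ Q.trace.re / 2 := by
  have key : ∀ s : ℂ, star s = s → s * s = 1 → 0 ≤ (Q.trace / 2 + s * (H * Q).trace).re := by
    intro s hs hs2
    -- For `s = ±1` this is the orthogonal projection onto the eigenspace of `H` at `s/2`; the claim
    -- is `tr (P Q P) ≥ 0`.
    set P : Matrix ι ι ℂ := (1 / 2 : ℂ) • (1 : Matrix ι ι ℂ) + s • H with hP
    have hPH : Pᴴ = P := by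
      rw [hP, Matrix.conjTranspose_add, Matrix.conjTranspose_smul, Matrix.conjTranspose_smul,
        hH.eq, hs, Matrix.conjTranspose_one]
      simp
    have hPP : P * P = P := by
      rw [hP]
      simp only [Matrix.add_mul, Matrix.mul_add, Matrix.smul_mul, Matrix.mul_smul, Matrix.one_mul,
        Matrix.mul_one, hsq, smul_smul]
      linear_combination (norm := module) (1 / 4 : ℂ) • congr_arg (· • (1 : Matrix ι ι ℂ)) hs2
    have h0 := trace_re_nonneg (hQ.mul_mul_conjTranspose_same P)
    rw [hPH, Matrix.trace_mul_comm, ← Matrix.mul_assoc, hPP, hP, Matrix.add_mul, Matrix.trace_add,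
      Matrix.smul_mul, Matrix.smul_mul, Matrix.trace_smul, Matrix.trace_smul, Matrix.one_mul,
      smul_eq_mul, smul_eq_mul] at h0
    convert h0 using 3
    ring
  have h1 := key 1 (by simp) (by simp)
  have h2 := key (-1) (by simp) (by simp)
  simp at h1 h2
  rw [abs_le]
  constructor <;> linarith

lemma IsMaximallyEntangled.abs_expectation_partialTranspose_le {φ : TwoQubitVec}
    (h : IsMaximallyEntangled φ) {Q : BiOp 2 2} (hQ : Q.PosSemidef) :
    |expectation φ (partialTranspose Q)| ≤ Q.trace.re / 2 := by
  rw [expectation_eq_trace, ← trace_partialTranspose_mul]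
  exact abs_trace_mul_le_of_sq (partialTranspose_isHermitian (posSemidef_ketbra φ).isHermitian)
    h.partialTranspose_sq hQ

/-! ### Forms constrained by the partial transpose -/

/-- Linear forms satisfying the constraints that the partial transpose puts on the fidelity
reached by an LOCC protocol. -/
structure IsPPTForm (f : BiOp 2 2 →ₗ[ℝ] ℝ) : Prop where
  nonneg : ∀ σ : BiOp 2 2, σ.PosSemidef → 0 ≤ f σ
  abs_apply_le : ∀ Q : BiOp 2 2, Q.PosSemidef → |f (partialTranspose Q)| ≤ Q.trace.re / 2

lemma IsLOCC.isPPTForm {Λ : BiOp 2 2 →ₗ[ℂ] BiOp 2 2} (h : IsLOCC Λ) {φ : TwoQubitVec}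
    (hφ : IsMaximallyEntangled φ) : IsPPTForm (expectationForm φ ∘ₗ Λ.restrictScalars ℝ) where
  nonneg σ hσ := expectation_nonneg φ (h.preserves.1 σ hσ)
  abs_apply_le Q hQ := by
    have := hφ.abs_expectation_partialTranspose_le (h.preserves.2.1 (partialTranspose Q) hQ)
    rwa [partialTranspose_partialTranspose, trace_partialTranspose, h.preserves.2.2,
      trace_partialTranspose] at this

/-- The value of a pair of filters, tested on a fixed maximally entangled state. -/
noncomputable def filterForm (A B : Matrix (Fin 2) (Fin 2) ℂ) (φ : TwoQubitVec) : BiOp 2 2 →ₗ[ℝ] ℝ :=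
  expectationForm φ ∘ₗ (sandwich (A ⊗ₖ B)).restrictScalars ℝ +
    (1 / 2 : ℝ) • (reTrace 2 2 - reTrace 2 2 ∘ₗ (sandwich (A ⊗ₖ B)).restrictScalars ℝ)

lemma filterForm_apply (A B : Matrix (Fin 2) (Fin 2) ℂ) (φ : TwoQubitVec) (σ : BiOp 2 2) :
    filterForm A B φ σ = expectation φ (sandwich (A ⊗ₖ B) σ) +
      1 / 2 * (σ.trace.re - successProb A B σ) := rfl

lemma successProb_nonneg (A B : Matrix (Fin 2) (Fin 2) ℂ) {σ : BiOp 2 2} (h : σ.PosSemidef) :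
    0 ≤ successProb A B σ :=
  trace_re_nonneg (posSemidef_sandwich _ h)

lemma IsFilter.map_star {A : Matrix (Fin 2) (Fin 2) ℂ} (h : IsFilter A) :
    IsFilter (A.map star) := by
  have e : 1 - (A.map star)ᴴ * A.map star = (1 - Aᴴ * A)ᵀ := by
    ext i j
    simp [Matrix.mul_apply, Matrix.one_apply, mul_comm, eq_comm]
  rw [IsFilter, e]
  exact h.transpose

open scoped MatrixOrder in
/-- A filter is one outcome of a two-outcome measurement. -/
lemma IsFilter.exists_completion {A : Matrix (Fin 2) (Fin 2) ℂ} (h : IsFilter A) :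
    ∃ D : Matrix (Fin 2) (Fin 2) ℂ, 1 = Aᴴ * A + Dᴴ * D := by
  obtain ⟨D, hD⟩ := CStarAlgebra.nonneg_iff_eq_star_mul_self.mp h.nonneg
  exact ⟨D, by rw [← Matrix.star_eq_conjTranspose D, ← hD]; abel⟩

/-- Completing both filters to measurements splits the trace over three outcomes: both pass, only
Alice passes, Alice fails. -/
lemma successProb_le {A B : Matrix (Fin 2) (Fin 2) ℂ} (hA : IsFilter A) (hB : IsFilter B)
    {σ : BiOp 2 2} (h : σ.PosSemidef) : successProb A B σ ≤ σ.trace.re := by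
  obtain ⟨A', hA'⟩ := hA.exists_completion
  obtain ⟨B', hB'⟩ := hB.exists_completion
  have e : σ.trace = (sandwich (A ⊗ₖ B) σ).trace + (sandwich (A ⊗ₖ B') σ).trace +
      (sandwich (A' ⊗ₖ (1 : Matrix (Fin 2) (Fin 2) ℂ)) σ).trace := by
    simp only [trace_sandwich, Matrix.conjTranspose_kronecker, ← Matrix.mul_kronecker_mul,
      ← Matrix.trace_add, ← Matrix.add_mul, ← Matrix.kronecker_add, ← hB']
    rw [Matrix.conjTranspose_one, Matrix.mul_one, ← Matrix.add_kronecker, ← hA',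
      Matrix.one_kronecker_one, Matrix.one_mul]
  have h1 := trace_re_nonneg (posSemidef_sandwich (A ⊗ₖ B') h)
  have h2 := trace_re_nonneg (posSemidef_sandwich (A' ⊗ₖ (1 : Matrix (Fin 2) (Fin 2) ℂ)) h)
  rw [e, successProb, Complex.add_re, Complex.add_re]
  linarith

/-- On `Q^Γ` the success branch contributes at most `p/2` in absolute value and the failure branch
exactly `(tr Q - p)/2`, where `p` is the success probability of `Q` under `A` and the conjugate of
`B`. -/
lemma IsMaximallyEntangled.isPPTForm_filterForm {A B : Matrix (Fin 2) (Fin 2) ℂ}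
    (hA : IsFilter A) (hB : IsFilter B) {φ : TwoQubitVec} (hφ : IsMaximallyEntangled φ) :
    IsPPTForm (filterForm A B φ) where
  nonneg σ hσ := by
    rw [filterForm_apply]
    have := expectation_nonneg φ (posSemidef_sandwich (A ⊗ₖ B) hσ)
    have := successProb_le hA hB hσ
    linarith
  abs_apply_le Q hQ := by
    have h1 := hφ.abs_expectation_partialTranspose_le
      (posSemidef_sandwich (A ⊗ₖ B.map star) hQ)
    have h2 := successProb_le hA hB.map_star hQ
    have h3 : successProb A B (partialTranspose Q) = successProb A (B.map star) Q := by
      rw [successProb, ← trace_partialTranspose, partialTranspose_sandwich]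
      rfl
    have h4 : partialTranspose (sandwich (A ⊗ₖ B.map star) Q) =
        sandwich (A ⊗ₖ B) (partialTranspose Q) := by
      rw [partialTranspose_sandwich]
      congr 3
      ext i j
      simp
    rw [h4] at h1
    change _ ≤ successProb A (B.map star) Q / 2 at h1
    rw [filterForm_apply, h3, trace_partialTranspose]
    rw [abs_le] at h1 ⊢
    constructor <;> linarith

/-! ### Dual certificates for `ρ(F)` -/

lemma inv_sqrt_two_mul_self : ((√2 : ℝ) : ℂ)⁻¹ * ((√2 : ℝ) : ℂ)⁻¹ = 2⁻¹ := by
  rw [← mul_inv, ← Complex.ofReal_mul, Real.mul_self_sqrt (by norm_num)]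
  norm_num

lemma isMaximallyEntangled_psiVec : IsMaximallyEntangled psiVec := by
  constructor <;> intro i j <;> fin_cases i <;> fin_cases j <;> simp [psiVec, inv_sqrt_two_mul_self]

lemma posSemidef_rhoF {F : ℝ} (hF : 0 ≤ F) (hF1 : F ≤ 1) : (rhoF F).PosSemidef :=
  ((posSemidef_ketbra _).smul hF).add ((posSemidef_ketbra _).smul (sub_nonneg.2 hF1))

lemma trace_ketbra {ι : Type*} [Fintype ι] (φ : ι → ℂ) :
    (ketbra φ).trace = ∑ i, φ i * star (φ i) := rfl

lemma trace_rhoF (F : ℝ) : (rhoF F).trace = 1 := by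
  simp [rhoF, trace_ketbra, Fintype.sum_prod_type, psiVec, ket01, inv_sqrt_two_mul_self,
    Pi.single_apply]

/-- On the span of `|01⟩, |10⟩`, `ρ(F)^Γ` is `[[1-F, F/2], [F/2, 0]]`. Adding `(1 - F) a² |10⟩⟨10|`,
which `Γ` fixes, completes the square to a rank-one positive block. -/
lemma rhoF_eq_partialTranspose_sub (F : ℝ) {a : ℝ} (ha : (1 - F) * a = F / 2) :
    rhoF F = partialTranspose ((F / 2) • ketbra (Pi.single (0, 0) 1) +
      (F / 2) • ketbra (Pi.single (1, 1) 1) +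
      (1 - F) • ketbra (Pi.single (0, 1) 1 + Pi.single (1, 0) (a : ℂ))) -
      ((1 - F) * a ^ 2) • ketbra (Pi.single (1, 0) 1) := by
  have ha' : (1 - (F : ℂ)) * a = F / 2 := by exact_mod_cast ha
  ext ⟨i, j⟩ ⟨k, l⟩
  fin_cases i <;> fin_cases j <;> fin_cases k <;> fin_cases l <;>
    simp [rhoF, ketbra, Matrix.vecMulVec_apply, partialTranspose_apply, psiVec, ket01,
      inv_sqrt_two_mul_self, ha'] <;> ring

/-- The dual bound in the regime where filtering helps. -/
lemma IsPPTForm.apply_rhoF_le_of_lt_one {f : BiOp 2 2 →ₗ[ℝ] ℝ} (hf : IsPPTForm f) {F : ℝ}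
    (hF : 0 ≤ F) (hF1 : F < 1) : f (rhoF F) ≤ 1 / 2 * (1 + F ^ 2 / (4 * (1 - F))) := by
  have h0 : 0 < 1 - F := by linarith
  obtain ⟨a, haF⟩ : ∃ a, a = F / (2 * (1 - F)) := ⟨_, rfl⟩
  have ha : (1 - F) * a = F / 2 := by rw [haF]; field_simp
  have hQ : ((F / 2) • ketbra (Pi.single (0, 0) 1) +
      (F / 2) • ketbra (Pi.single (1, 1) 1) +
      (1 - F) • ketbra (Pi.single (0, 1) 1 + Pi.single (1, 0) (a : ℂ)) : BiOp 2 2).PosSemidef :=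
    (((posSemidef_ketbra _).smul (by positivity)).add
      ((posSemidef_ketbra _).smul (by positivity))).add ((posSemidef_ketbra _).smul h0.le)
  have h1 := (abs_le.1 (hf.abs_apply_le _ hQ)).2
  have h2 := hf.nonneg _ (posSemidef_ketbra (Pi.single (1, 0) 1))
  rw [rhoF_eq_partialTranspose_sub F ha, map_sub, map_smul, smul_eq_mul]
  have h3 : 0 ≤ (1 - F) * a ^ 2 := by positivity
  refine (sub_le_self _ (mul_nonneg h3 h2)).trans (h1.trans_eq ?_)
  simp [trace_ketbra, Fintype.sum_prod_type, Pi.single_apply]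
  rw [haF]
  field_simp
  ring

/-- Adding `(1 - F) |10⟩⟨10|` makes the same block `[[1-F, F/2], [F/2, 1-F]]`, with eigenvalues `1 -
F/2` and `1 - 3F/2`. The second is nonpositive exactly when `F ≥ 2/3`, and the block is then split
into its positive and negative parts; the extra halves normalize the eigenvectors. -/
lemma rhoF_eq_partialTranspose_sub_sub (F : ℝ) :
    rhoF F = partialTranspose ((F / 2) • ketbra (Pi.single (0, 0) 1) +
      (F / 2) • ketbra (Pi.single (1, 1) 1) +
      ((1 - F / 2) / 2) • ketbra (Pi.single (0, 1) 1 + Pi.single (1, 0) 1)) -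
      partialTranspose
        (((3 * F / 2 - 1) / 2) • ketbra (Pi.single (0, 1) 1 - Pi.single (1, 0) 1)) -
      (1 - F) • ketbra (Pi.single (1, 0) 1) := by
  ext ⟨i, j⟩ ⟨k, l⟩
  fin_cases i <;> fin_cases j <;> fin_cases k <;> fin_cases l <;>
    simp [rhoF, ketbra, Matrix.vecMulVec_apply, partialTranspose_apply, psiVec, ket01,
      inv_sqrt_two_mul_self] <;> ring

/-- The dual bound in the regime where filtering does not help. -/
lemma IsPPTForm.apply_rhoF_le_of_ge {f : BiOp 2 2 →ₗ[ℝ] ℝ} (hf : IsPPTForm f) {F : ℝ}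
    (hF : 2 / 3 ≤ F) (hF1 : F ≤ 1) : f (rhoF F) ≤ F := by
  have hQ : ((F / 2) • ketbra (Pi.single (0, 0) 1) +
      (F / 2) • ketbra (Pi.single (1, 1) 1) +
      ((1 - F / 2) / 2) • ketbra (Pi.single (0, 1) 1 + Pi.single (1, 0) 1) :
        BiOp 2 2).PosSemidef :=
    (((posSemidef_ketbra _).smul (by linarith)).add
      ((posSemidef_ketbra _).smul (by linarith))).add ((posSemidef_ketbra _).smul (by linarith))
  have hR : (((3 * F / 2 - 1) / 2) • ketbra (Pi.single (0, 1) 1 - Pi.single (1, 0) 1) :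
      BiOp 2 2).PosSemidef := (posSemidef_ketbra _).smul (by linarith)
  have h1 := (abs_le.1 (hf.abs_apply_le _ hQ)).2
  have h2 := (abs_le.1 (hf.abs_apply_le _ hR)).1
  have h3 := mul_nonneg (sub_nonneg.2 hF1)
    (hf.nonneg _ (posSemidef_ketbra (Pi.single (1, 0) 1)))
  rw [rhoF_eq_partialTranspose_sub_sub F, map_sub, map_sub, map_smul _ (1 - F), smul_eq_mul]
  refine (sub_le_self _ h3).trans ((sub_le_sub h1 h2).trans_eq ?_)
  simp [trace_ketbra, Fintype.sum_prod_type, Pi.single_apply]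
  ring

/-! ### The fidelity and its value at `ρ(F)` -/

lemma fidelity_le {ρ : BiOp 2 2} {c : ℝ}
    (h : ∀ φ, IsMaximallyEntangled φ → expectation φ ρ ≤ c) : fidelity ρ ≤ c :=
  csSup_le ⟨_, _, isMaximallyEntangled_psiVec, rfl⟩ (by rintro _ ⟨φ, hφ, rfl⟩; exact h φ hφ)


lemma IsMaximallyEntangled.isUnitVec {φ : TwoQubitVec} (hφ : IsMaximallyEntangled φ) :
    IsUnitVec φ := by
  have h0 := hφ.1 0 0
  have h1 := hφ.1 1 1
  simp only [Fin.sum_univ_two, if_true] at h0 h1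
  simp only [IsUnitVec, dotProduct, Fintype.sum_prod_type, Fin.sum_univ_two, Pi.star_apply]
  linear_combination h0 + h1

lemma IsUnitVec.expectation_le_trace {ι : Type*} [Fintype ι] {φ : ι → ℂ} (hφ : IsUnitVec φ)
    {ρ : Matrix ι ι ℂ} (h : ρ.PosSemidef) : expectation φ ρ ≤ ρ.trace.re := by
  classical
  have hP : ketbra φ * ketbra φ = ketbra φ := by
    rw [ketbra, Matrix.vecMulVec_mul_vecMulVec, hφ, one_smul]
  have h0 := trace_re_nonneg (h.mul_mul_conjTranspose_same (1 - ketbra φ))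
  rw [Matrix.conjTranspose_sub, (posSemidef_ketbra φ).isHermitian.eq, Matrix.conjTranspose_one,
    Matrix.trace_mul_comm, ← Matrix.mul_assoc, Matrix.mul_sub, Matrix.mul_one,
    Matrix.sub_mul 1 _ (ketbra φ), Matrix.one_mul, hP, sub_self, sub_zero, Matrix.sub_mul,
    Matrix.trace_sub, Matrix.one_mul, Complex.sub_re, ← expectation_eq_trace] at h0
  linarith

/-- Positivity bounds the set of expectations by the trace, so the `sSup` is a genuine supremum. -/
lemma le_fidelity {ρ : BiOp 2 2} (h : ρ.PosSemidef) {φ : TwoQubitVec}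
    (hφ : IsMaximallyEntangled φ) : expectation φ ρ ≤ fidelity ρ :=
  le_csSup ⟨ρ.trace.re, by rintro _ ⟨φ, hφ, rfl⟩; exact hφ.isUnitVec.expectation_le_trace h⟩
    ⟨φ, hφ, rfl⟩

lemma expectation_ketbra {ι : Type*} [Fintype ι] (φ v : ι → ℂ) :
    expectation φ (ketbra v) = ‖star v ⬝ᵥ φ‖ ^ 2 := by
  have h : star φ ⬝ᵥ v = star (star v ⬝ᵥ φ) := Matrix.star_dotProduct _ _
  rw [expectation, ketbra, Matrix.vecMulVec_mulVec, dotProduct_smul, op_smul_eq_mul, h]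
  simp [← Complex.normSq_eq_norm_sq, Complex.normSq_apply]

lemma sandwich_ketbra {ι κ : Type*} [Fintype ι] [Fintype κ] (K : Matrix κ ι ℂ) (v : ι → ℂ) :
    sandwich K (ketbra v) = ketbra (K *ᵥ v) := by
  rw [sandwich_apply, ketbra, Matrix.mul_vecMulVec, Matrix.vecMulVec_mul, ketbra,
    Matrix.star_mulVec]

lemma sandwich_real_smul {ι κ : Type*} [Fintype ι] [Fintype κ] (K : Matrix κ ι ℂ) (c : ℝ)
    (σ : Matrix ι ι ℂ) : sandwich K (c • σ) = c • sandwich K σ :=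
  map_smul ((sandwich K).restrictScalars ℝ) c σ

lemma expectation_rhoF (φ : TwoQubitVec) (F : ℝ) : expectation φ (rhoF F) =
    F / 2 * ‖φ (0, 0) + φ (1, 1)‖ ^ 2 + (1 - F) * ‖φ (0, 1)‖ ^ 2 := by
  have h0 : star psiVec ⬝ᵥ φ = ((√2 : ℝ) : ℂ)⁻¹ * (φ (0, 0) + φ (1, 1)) := by
    simp [dotProduct, Fintype.sum_prod_type, psiVec, mul_add]
  have h1 : star ket01 ⬝ᵥ φ = φ (0, 1) := by
    simp [dotProduct, ket01, Pi.single_apply]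
  rw [← expectationForm_apply, rhoF, map_add, map_smul, map_smul, expectationForm_apply,
    expectationForm_apply, expectation_ketbra, expectation_ketbra, h0, h1, norm_mul, mul_pow]
  simp
  ring

lemma fidelity_rhoF {F : ℝ} (hF : 1 / 3 ≤ F) (hF1 : F ≤ 1) : fidelity (rhoF F) = F := by
  refine le_antisymm (fidelity_le fun φ hφ => ?_) ?_
  · have e (z : ℂ) : z * star z = ((‖z‖ ^ 2 : ℝ) : ℂ) := by
      rw [← Complex.normSq_eq_norm_sq]; exact Complex.mul_conj z
    have e0 : ‖φ (0, 0)‖ ^ 2 + ‖φ (0, 1)‖ ^ 2 = 1 / 2 := by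
      have := hφ.1 0 0
      simp only [Fin.sum_univ_two, if_true, e] at this
      exact Complex.ofReal_injective (by push_cast at this ⊢; exact this)
    have e1 : ‖φ (0, 1)‖ ^ 2 + ‖φ (1, 1)‖ ^ 2 = 1 / 2 := by
      have := hφ.2 1 1
      simp only [Fin.sum_univ_two, if_true, e] at this
      exact Complex.ofReal_injective (by push_cast at this ⊢; exact this)
    have h1 := pow_le_pow_left₀ (norm_nonneg _) (norm_add_le (φ (0, 0)) (φ (1, 1))) 2
    have h2 : ‖φ (0, 0) + φ (1, 1)‖ ^ 2 ≤ 4 * (1 / 2 - ‖φ (0, 1)‖ ^ 2) := by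
      nlinarith [sq_nonneg (‖φ (0, 0)‖ - ‖φ (1, 1)‖)]
    rw [expectation_rhoF]
    -- With `t = |φ₀₁|²` the expectation is at most `F + (1 - 3F) t`, and `F ≥ 1/3`.
    nlinarith [sq_nonneg (‖φ (0, 1)‖)]
  · refine le_of_eq_of_le ?_
      (le_fidelity (posSemidef_rhoF (by linarith) hF1) isMaximallyEntangled_psiVec)
    have : (√2)⁻¹ + (√2)⁻¹ = √2 := by
      field_simp
      norm_num
    rw [expectation_rhoF]
    simp [psiVec]
    rw [← Complex.ofReal_inv, ← Complex.ofReal_add, this, Complex.norm_real]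
    simp

/-! ### Filter protocols are LOCC -/

/-- Discarding both qubits and preparing a pure product state is LOCC. -/
lemma isLOCC_prepare {α β : Fin 2 → ℂ} (hα : IsUnitVec α) (hβ : IsUnitVec β) :
    IsLOCC ((Matrix.traceLinearMap (Fin 2 × Fin 2) ℂ ℂ).smulRight (ketbra (productVec α β)) :
      BiOp 2 2 →ₗ[ℂ] BiOp 2 2) := by
  have hc {v : Fin 2 → ℂ} (hv : IsUnitVec v) :
      ∑ i, (Matrix.vecMulVec v (Pi.single i 1))ᴴ * Matrix.vecMulVec v (Pi.single i 1) =
        (1 : Matrix (Fin 2) (Fin 2) ℂ) := by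
    simp only [Matrix.conjTranspose_vecMulVec, Matrix.vecMulVec_mul_vecMulVec,
      show star v ⬝ᵥ v = 1 from hv, one_smul]
    ext i j
    fin_cases i <;> fin_cases j <;> simp [Matrix.vecMulVec_apply]
  -- Alice measures with Kraus operators `|α⟩⟨i|`, then Bob with `|β⟩⟨j|`, both ignoring the
  -- outcomes.
  convert IsLOCC.alice (fun _ : Fin 2 => 2) (fun i => Matrix.vecMulVec α (Pi.single i 1)) (hc hα)
    (fun _ => ∑ j : Fin 2, LinearMap.id ∘ₗ sandwich ((1 : Matrix (Fin 2) (Fin 2) ℂ) ⊗ₖ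
      Matrix.vecMulVec β (Pi.single j 1)))
    (fun _ => IsLOCC.bob (fun _ : Fin 2 => 2) _ (hc hβ) _ fun _ => IsLOCC.stop_here) using 1
  refine LinearMap.ext fun σ => ?_
  have e (i j : Fin 2) : sandwich ((1 : Matrix (Fin 2) (Fin 2) ℂ) ⊗ₖ
        Matrix.vecMulVec β (Pi.single j 1))
      (sandwich (Matrix.vecMulVec α (Pi.single i 1) ⊗ₖ (1 : Matrix (Fin 2) (Fin 2) ℂ)) σ) =
      sandwich (Matrix.vecMulVec α (Pi.single i 1) ⊗ₖ Matrix.vecMulVec β (Pi.single j 1)) σ := by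
    simp only [sandwich_apply]
    rw [← Matrix.mul_assoc, ← Matrix.mul_assoc, Matrix.mul_assoc _ _ (_ᴴ),
      ← Matrix.conjTranspose_mul, ← Matrix.mul_kronecker_mul, Matrix.one_mul, Matrix.mul_one]
  simp only [LinearMap.sum_apply, LinearMap.comp_apply, LinearMap.id_apply, e]
  ext p q
  simp [Matrix.sum_apply, sandwich_kronecker_apply, Matrix.vecMulVec_apply, Matrix.trace,
    Fintype.sum_prod_type, ketbra, productVec]
  ring

lemma IsFilter.isLOCC_filterProtocol {A : Matrix (Fin 2) (Fin 2) ℂ} (hA : IsFilter A)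
    {α β : Fin 2 → ℂ} (hα : IsUnitVec α) (hβ : IsUnitVec β) : IsLOCC (filterProtocol A α β) := by
  obtain ⟨D, hD⟩ := hA.exists_completion
  convert IsLOCC.alice (fun _ : Fin 2 => 2) ![A, D] (by simp [← hD])
    ![LinearMap.id, (Matrix.traceLinearMap (Fin 2 × Fin 2) ℂ ℂ).smulRight
      (ketbra (productVec α β))]
    (by
      intro i
      fin_cases i
      exacts [IsLOCC.stop_here, isLOCC_prepare hα hβ]) using 1
  refine LinearMap.ext fun σ => ?_
  have e : σ.trace = (sandwich (A ⊗ₖ (1 : Matrix (Fin 2) (Fin 2) ℂ)) σ).trace +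
      (sandwich (D ⊗ₖ (1 : Matrix (Fin 2) (Fin 2) ℂ)) σ).trace := by
    simp only [trace_sandwich, Matrix.conjTranspose_kronecker, ← Matrix.mul_kronecker_mul,
      ← Matrix.trace_add, ← Matrix.add_mul, ← Matrix.add_kronecker, ← hD]
    rw [Matrix.conjTranspose_one, Matrix.mul_one, Matrix.one_kronecker_one, Matrix.one_mul]
  simp [filterProtocol, Fin.sum_univ_two, e]

/-! ### From bounds on forms to optimal filters -/

lemma expectation_filteredState {A B : Matrix (Fin 2) (Fin 2) ℂ} {ρ : BiOp 2 2}
    (hp : successProb A B ρ ≠ 0) (φ : TwoQubitVec) :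
    successProb A B ρ * expectation φ (filteredState A B ρ) =
      expectation φ (sandwich (A ⊗ₖ B) ρ) := by
  rw [← expectationForm_apply, filteredState, map_smul, smul_eq_mul, mul_inv_cancel_left₀ hp,
    expectationForm_apply]

lemma posSemidef_filteredState (A B : Matrix (Fin 2) (Fin 2) ℂ) {ρ : BiOp 2 2}
    (h : ρ.PosSemidef) : (filteredState A B ρ).PosSemidef :=
  (posSemidef_sandwich _ h).smul (inv_nonneg.2 (successProb_nonneg A B h))

lemma filterValue_le {A B : Matrix (Fin 2) (Fin 2) ℂ} {ρ : BiOp 2 2} (hA : IsFilter A)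
    (hB : IsFilter B) (hρ : ρ.PosSemidef) (htr : ρ.trace = 1) {c : ℝ}
    (hc : ∀ f, IsPPTForm f → f ρ ≤ c) : filterValue A B ρ ≤ c := by
  have hφ (φ) (hφ : IsMaximallyEntangled φ) := hc _ (hφ.isPPTForm_filterForm hA hB)
  simp only [filterForm_apply, htr, Complex.one_re] at hφ
  rw [filterValue]
  rcases (successProb_nonneg A B hρ).eq_or_lt with h0 | h0
  -- At `p = 0` the value is `1/2` whatever the fidelity term, and testing on `ψ` gives `1/2 ≤ c`.
  · have h1 := hφ _ isMaximallyEntangled_psiVec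
    have h2 := expectation_nonneg psiVec (posSemidef_sandwich (A ⊗ₖ B) hρ)
    rw [← h0] at h1 ⊢
    linarith
  · have : fidelity (filteredState A B ρ) ≤
        (c - (1 - successProb A B ρ) / 2) / successProb A B ρ := by
      refine fidelity_le fun φ h => ?_
      have := hφ φ h
      rw [← expectation_filteredState h0.ne'] at this
      rw [le_div_iff₀ h0]
      linarith
    rw [le_div_iff₀ h0] at this
    linarith

lemma isFilter_one : IsFilter 1 := by
  simpa [IsFilter] using Matrix.PosSemidef.zero

lemma norm_star_dotProduct_psiVec :
    ‖star (productVec (Pi.single 0 1) (Pi.single 0 1)) ⬝ᵥ psiVec‖ ^ 2 = 1 / 2 := by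
  simp [dotProduct, Fintype.sum_prod_type, productVec, psiVec, Pi.single_apply]

/-- A filter whose value, tested on `|ψ⟩`, meets a bound on all PPT forms is optimal. -/
lemma IsFilter.isOptimalFilter_of_forall_le {A : Matrix (Fin 2) (Fin 2) ℂ} (hA : IsFilter A)
    {ρ : BiOp 2 2} (hρ : ρ.PosSemidef) (htr : ρ.trace = 1) {c : ℝ}
    (hc : ∀ f, IsPPTForm f → f ρ ≤ c) (hp : 0 < successProb A 1 ρ)
    (hA1 : c ≤ filterForm A 1 psiVec ρ) :
    IsOptimalFilter ρ A ∧ IsGreatest (loccFidelities ρ) (Fstar ρ) ∧ Fstar ρ = c := by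
  have hψ := le_fidelity (posSemidef_filteredState A 1 hρ) isMaximallyEntangled_psiVec
  have hle := filterValue_le hA isFilter_one hρ htr hc
  rw [filterForm_apply, ← expectation_filteredState hp.ne', htr, Complex.one_re] at hA1
  have hval : c = filterValue A 1 ρ :=
    le_antisymm (by
      have := mul_le_mul_of_nonneg_left hψ hp.le
      rw [filterValue]
      linarith) hle
  -- The chain `c ≤ value on ψ ≤ filterValue ≤ c` collapses, so `ψ` realizes the fidelity and `|00⟩`
  -- is a failure state.
  have hψeq : expectation psiVec (filteredState A 1 ρ) = fidelity (filteredState A 1 ρ) := by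
    refine le_antisymm hψ (le_of_mul_le_mul_left ?_ hp)
    rw [filterValue] at hle
    linarith
  have hfail : IsFailureState A ρ (Pi.single 0 1) (Pi.single 0 1) :=
    ⟨by simp [IsUnitVec, dotProduct], by simp [IsUnitVec, dotProduct], psiVec,
      isMaximallyEntangled_psiVec, hψeq, norm_star_dotProduct_psiVec⟩
  have hupper (Λ : BiOp 2 2 →ₗ[ℂ] BiOp 2 2) (hΛ : IsLOCC Λ) : fidelity (Λ ρ) ≤ c :=
    fidelity_le fun φ hφ => hc _ (hΛ.isPPTForm hφ)
  have hprot (α β) (h : IsFailureState A ρ α β) :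
      IsLOCC (filterProtocol A α β) ∧ fidelity (filterProtocol A α β ρ) = c := by
    obtain ⟨hα, hβ, φ, hφ, hφeq, hφn⟩ := h
    have hL := hA.isLOCC_filterProtocol hα hβ
    refine ⟨hL, le_antisymm (hupper _ hL) ?_⟩
    -- Tested on `φ`, the failure branch contributes `(1 - p)/2` because the overlap is `1/2`, so
    -- the output has expectation exactly `filterValue A 1 ρ = c`.
    refine le_of_eq_of_le ?_ (le_fidelity (hL.preserves.1 _ hρ) hφ)
    have him : (sandwich (A ⊗ₖ (1 : Matrix (Fin 2) (Fin 2) ℂ)) ρ).trace =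
        (successProb A 1 ρ : ℂ) :=
      Complex.ext rfl (Complex.nonneg_iff.1 (posSemidef_sandwich _ hρ).trace_nonneg).2.symm
    have e : filterProtocol A α β ρ = sandwich (A ⊗ₖ (1 : Matrix (Fin 2) (Fin 2) ℂ)) ρ +
        (1 - successProb A 1 ρ) • ketbra (productVec α β) := by
      simp only [filterProtocol, LinearMap.add_apply, LinearMap.smulRight_apply,
        LinearMap.sub_apply, LinearMap.comp_apply, Matrix.traceLinearMap_apply, htr, him]
      rw [← Complex.coe_smul]
      simp
    rw [e, ← expectationForm_apply, map_add, map_smul, expectationForm_apply,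
      expectationForm_apply, expectation_ketbra, hφn, ← expectation_filteredState hp.ne', hφeq,
      smul_eq_mul, hval, filterValue]
    ring
  have hgr : IsGreatest (loccFidelities ρ) c :=
    ⟨⟨_, (hprot _ _ hfail).1, (hprot _ _ hfail).2.symm⟩, by
      rintro _ ⟨Λ, hΛ, rfl⟩
      exact hupper Λ hΛ⟩
  have hF : Fstar ρ = c := hgr.csSup_eq
  refine ⟨⟨hA, fun A' B' hA' hB' => ?_, ⟨_, _, hfail⟩, fun α β h => ?_⟩, ?_, hF⟩
  · exact hval ▸ filterValue_le hA' hB' hρ htr hc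
  · rw [hF]
    exact hprot α β h
  · rwa [hF]

/-! ### Diagonal filters on `ρ(F)` and the theorem -/

lemma sandwich_rhoF (K : BiOp 2 2) (F : ℝ) : sandwich K (rhoF F) =
    F • ketbra (K *ᵥ psiVec) + (1 - F) • ketbra (K *ᵥ ket01) := by
  rw [rhoF, map_add, sandwich_real_smul, sandwich_real_smul, sandwich_ketbra, sandwich_ketbra]

lemma diagonal_kronecker_one_mulVec_psiVec (a : ℂ) :
    (!![a, 0; 0, 1] ⊗ₖ (1 : Matrix (Fin 2) (Fin 2) ℂ)) *ᵥ psiVec =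
      ((√2 : ℝ) : ℂ)⁻¹ • (Pi.single (0, 0) a + Pi.single (1, 1) 1) := by
  ext ⟨i, j⟩
  fin_cases i <;> fin_cases j <;>
    simp [Matrix.mulVec, dotProduct, Fintype.sum_prod_type, psiVec, mul_comm]

lemma diagonal_kronecker_one_mulVec_ket01 (a : ℂ) :
    (!![a, 0; 0, 1] ⊗ₖ (1 : Matrix (Fin 2) (Fin 2) ℂ)) *ᵥ ket01 = Pi.single (0, 1) a := by
  ext ⟨i, j⟩
  fin_cases i <;> fin_cases j <;> simp [ket01]

lemma ketbra_inv_sqrt_two_smul {ι : Type*} (v : ι → ℂ) :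
    ketbra (((√2 : ℝ) : ℂ)⁻¹ • v) = (1 / 2 : ℝ) • ketbra v := by
  ext i j
  simp only [ketbra, Matrix.vecMulVec_apply, Matrix.smul_apply, Pi.smul_apply, Pi.star_apply,
    star_smul, smul_eq_mul, Complex.real_smul, star_inv₀, Complex.star_def, Complex.conj_ofReal]
  push_cast
  linear_combination (v i * starRingEnd ℂ (v j)) * inv_sqrt_two_mul_self

lemma sandwich_diagonal_rhoF (a : ℂ) (F : ℝ) :
    sandwich (!![a, 0; 0, 1] ⊗ₖ (1 : Matrix (Fin 2) (Fin 2) ℂ)) (rhoF F) =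
      (F / 2) • ketbra (Pi.single (0, 0) a + Pi.single (1, 1) 1) +
        (1 - F) • ketbra (Pi.single (0, 1) a) := by
  rw [sandwich_rhoF, diagonal_kronecker_one_mulVec_psiVec, diagonal_kronecker_one_mulVec_ket01,
    ketbra_inv_sqrt_two_smul, smul_smul, mul_one_div]

lemma successProb_diagonal_rhoF (a F : ℝ) :
    successProb !![(a : ℂ), 0; 0, 1] 1 (rhoF F) = F * (a ^ 2 + 1) / 2 + (1 - F) * a ^ 2 := by
  rw [successProb, sandwich_diagonal_rhoF]
  simp [trace_ketbra, Fintype.sum_prod_type, Pi.single_apply]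
  ring

lemma expectation_diagonal_rhoF (a F : ℝ) :
    expectation psiVec (sandwich (!![(a : ℂ), 0; 0, 1] ⊗ₖ (1 : Matrix (Fin 2) (Fin 2) ℂ))
      (rhoF F)) = F * (a + 1) ^ 2 / 4 := by
  have h0 : star (Pi.single (0, 0) (a : ℂ) + Pi.single (1, 1) 1) ⬝ᵥ psiVec =
      (((√2)⁻¹ * (a + 1) : ℝ) : ℂ) := by
    simp [dotProduct, Fintype.sum_prod_type, psiVec, Pi.single_apply]
    ring
  have h1 : star (Pi.single (0, 1) (a : ℂ)) ⬝ᵥ psiVec = 0 := by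
    simp [dotProduct, Fintype.sum_prod_type, psiVec, Pi.single_apply]
  rw [sandwich_diagonal_rhoF, ← expectationForm_apply, map_add, map_smul, map_smul,
    expectationForm_apply, expectationForm_apply, expectation_ketbra, expectation_ketbra, h0, h1,
    Complex.norm_real, Real.norm_eq_abs, sq_abs, mul_pow, inv_pow, Real.sq_sqrt zero_le_two]
  simp
  ring

lemma isFilter_diagonal {a : ℝ} (ha : 0 ≤ a) (ha1 : a ≤ 1) : IsFilter !![(a : ℂ), 0; 0, 1] := by
  have h : 1 - (!![(a : ℂ), 0; 0, 1])ᴴ * !![(a : ℂ), 0; 0, 1] =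
      (1 - a ^ 2) • ketbra (Pi.single 0 1) := by
    ext i j
    fin_cases i <;> fin_cases j <;>
      simp [Matrix.mul_apply, ketbra, Matrix.vecMulVec_apply, pow_two]
  rw [IsFilter, h]
  exact (posSemidef_ketbra _).smul (sub_nonneg.2 (pow_le_one₀ ha ha1))

theorem mainTheorem5 (F : ℝ) (hF : 1 / 3 ≤ F) (hF1 : F ≤ 1) :
    fidelity (rhoF F) = F ∧
    IsGreatest (loccFidelities (rhoF F)) (Fstar (rhoF F)) ∧
    (F ≤ 2 / 3 →
      IsOptimalFilter (rhoF F) !![((F / (2 * (1 - F)) : ℝ) : ℂ), 0; 0, 1] ∧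
      Fstar (rhoF F) = 1 / 2 * (1 + F ^ 2 / (4 * (1 - F)))) ∧
    (2 / 3 ≤ F →
      IsOptimalFilter (rhoF F) 1 ∧
      Fstar (rhoF F) = F ∧
      ∀ Λ : BiOp 2 2 →ₗ[ℂ] BiOp 2 2, IsLOCC Λ →
        fidelity (Λ (rhoF F)) ≤ fidelity (rhoF F)) := by
  have hρ := posSemidef_rhoF (by linarith) hF1
  have hlow (h : F ≤ 2 / 3) := by
    have h0 : 0 < 1 - F := by linarith
    have hF0 : 0 < F := by linarith
    -- The filter condition `a ≤ 1` amounts to `F ≤ 2/3`.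
    have ha1 : F / (2 * (1 - F)) ≤ 1 := by rw [div_le_one (by positivity)]; linarith
    refine (isFilter_diagonal (by positivity) ha1).isOptimalFilter_of_forall_le hρ (trace_rhoF F)
      (fun f hf => hf.apply_rhoF_le_of_lt_one hF0.le (by linarith)) ?_ ?_
    · rw [successProb_diagonal_rhoF]
      positivity
    · rw [filterForm_apply, successProb_diagonal_rhoF, expectation_diagonal_rhoF, trace_rhoF,
        Complex.one_re]
      refine le_of_eq ?_
      field_simp
      ring
  have hhigh (h : 2 / 3 ≤ F) := by
    -- The identity is the case `a = 1` of the diagonal family, so the same formulas apply.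
    have h1 : (1 : Matrix (Fin 2) (Fin 2) ℂ) = !![((1 : ℝ) : ℂ), 0; 0, 1] := by
      simp [Matrix.one_fin_two]
    refine isFilter_one.isOptimalFilter_of_forall_le hρ (trace_rhoF F)
      (fun f hf => hf.apply_rhoF_le_of_ge h hF1) ?_ ?_
    · nth_rw 1 [h1]
      rw [successProb_diagonal_rhoF]
      linarith
    · rw [filterForm_apply]
      nth_rw 1 [h1]
      nth_rw 2 [h1]
      rw [successProb_diagonal_rhoF, expectation_diagonal_rhoF, trace_rhoF, Complex.one_re]
      linarith
  refine ⟨fidelity_rhoF hF hF1, ?_, fun h => ⟨(hlow h).1, (hlow h).2.2⟩, fun h =>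
    ⟨(hhigh h).1, (hhigh h).2.2, fun Λ hΛ => ?_⟩⟩
  · rcases le_total F (2 / 3) with h | h
    exacts [(hlow h).2.1, (hhigh h).2.1]
  · rw [fidelity_rhoF hF hF1]
    exact ((hhigh h).2.1.2 ⟨Λ, hΛ, rfl⟩).trans_eq (hhigh h).2.2
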